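/- **Proposition 4.5 (Uniform convergence of $S_{q,\varepsilon}^{x_0}$).** Let $(\Sigma,\mathcal F,\mathbb P)$ be a probability space and $\{\tau_y\}_{y\in\mathbb R}$ a group of measure-preserving transformations of $\Sigma$ with $\tau_0=\mathrm{id}$ and $\tau_y\circ\tau_z=\tau_{y+z}$, ergodic in the sense that every $E\in\mathcal F$ with $\tau_yE=E$ for all $y\in\mathbb R$ has $\mathbb P[E]\in\{0,1\}$. Let $a,b,g:\mathbb R\times\Sigma\to\mathbb R$ be such that, for some constants $0<c\le C$ and $K$, we have $c\le a,b\le C$ and $g\ge 0$ on $\mathbb R\times\Sigma$; the functions $a(\cdot,\omega),b(\cdot,\omega),g(\cdot,\omega)$ are Lipschitz continuous with constant $K$ for every $\omega\in\Sigma$; and each $f\in\{a,b,g\}$ is stationary, that is, $f(x,\cdot)$ is measurable for every $x$ and $f(y+z,\omega)=f(y,\tau_z\omega)$ for all $y,z\in\mathbb R$ and $\omega\in\Sigma$. Define $\overline a>0$ by $1/\overline a=\mathbb E[1/a(0,\cdot)]$, and let $q>0$. For $x_0\in\mathbb R$ and $\omega\in\Sigma$ let $S_q^{x_0}(\cdot,\omega)$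 be the solution on $[0,\infty)$ of $$\frac{d}{dt}S(t)=q\,b(S(t),\omega)\,\frac{\overline a}{a(S(t),\omega)}+g(S(t),\omega),\qquad S(0)=x_0 ,$$ and for $\varepsilon>0$ put $$S_{q,\varepsilon}^{x_0}(t,\omega):=\varepsilon\bigl(S_q^{x_0}(\varepsilon^{-1}t,\omega)-x_0\bigr)+x_0 .$$ For $x_1>x_0$ let $T_q(x_1;x_0,\omega):=\inf\{t>0 \mid S_q^{x_0}(t,\omega)=x_1\}$. Then there is a constant $\overline T_q>0$, independent of $x_0$ and $\omega$, such that for every $x_0\in\mathbb R$, almost surely, $\lim_{r\to\infty}T_q(x_0+r;x_0,\omega)/r=\overline T_q$. Moreover, with the effective velocity $\overline V_q:=1/\overline T_q$, the following holds: for every $x_0\in\mathbb R$, $\Lambda>0$ and $t_1>t_0>0$ there is a set $\Sigma_0\subset\Sigma$ of full measure such that for every $\omega\in\Sigma_0$, $$\lim_{\varepsilon\to 0^+}\ \sup_{|y|\le\Lambda/\varepsilon,\ t\in[t_0,t_1]}\left|S_{q,\varepsilon}^{x_0}(t,\tau_y\omega)-x_0-\overline V_q\,t\right|=0 .$$ 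-/

import Mathlib

open MeasureTheory Set Filter Topology

namespace FrontODE

/-- A measure-preserving group `τ y`, `y ∈ ℝ`, of transformations of a probability space which is
ergodic: every event that is invariant under all the `τ y` has probability `0` or `1`. -/
structure IsErgodicGroup {Ω : Type*} [MeasurableSpace Ω] (P : Measure Ω) (τ : ℝ → Ω → Ω) :
    Prop where
  measurePreserving : ∀ y, MeasurePreserving (τ y) P P
  zero : ∀ ω, τ 0 ω = ω
  add : ∀ y z ω, τ y (τ z ω) = τ (y + z) ω
  ergodic : ∀ E : Set Ω, MeasurableSet E → (∀ y, τ y '' E = E) → P E = 0 ∨ P E = 1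

/-- A stationary random field `f : ℝ × Ω → ℝ` with respect to the transformations `τ`. -/
structure IsStationaryField {Ω : Type*} [MeasurableSpace Ω] (τ : ℝ → Ω → Ω) (f : ℝ → Ω → ℝ) :
    Prop where
  measurable : ∀ x, Measurable (f x)
  stationary : ∀ y z ω, f (y + z) ω = f y (τ z ω)

/-- `f` takes values in a compact subinterval of `(0, ∞)`, uniformly in `x` and `ω`. -/
def UniformlyPositiveFinite {Ω : Type*} (f : ℝ → Ω → ℝ) : Prop :=
  ∃ c C : ℝ, 0 < c ∧ ∀ x ω, c ≤ f x ω ∧ f x ω ≤ C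

/-- `f` is Lipschitz continuous in `x`, with a constant that does not depend on `ω`. -/
def UniformlyLipschitz {Ω : Type*} (f : ℝ → Ω → ℝ) : Prop :=
  ∃ K : ℝ, ∀ x y ω, |f x ω - f y ω| ≤ K * |x - y|

/-- The standing hypotheses on the coefficients `a`, `b`, `g`. -/
structure IsAdmissible {Ω : Type*} [MeasurableSpace Ω] (τ : ℝ → Ω → Ω) (a b g : ℝ → Ω → ℝ) :
    Prop where
  a_pos_finite : UniformlyPositiveFinite a
  b_pos_finite : UniformlyPositiveFinite b
  g_nonneg : ∀ x ω, 0 ≤ g x ω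
  a_lipschitz : UniformlyLipschitz a
  b_lipschitz : UniformlyLipschitz b
  g_lipschitz : UniformlyLipschitz g
  a_stationary : IsStationaryField τ a
  b_stationary : IsStationaryField τ b
  g_stationary : IsStationaryField τ g

/-- `S` solves `S' = v(S)` on `[0, ∞)` with `S(0) = x₀` (one-sided derivative at `0`). -/
def IsForwardSolution (v : ℝ → ℝ) (x₀ : ℝ) (S : ℝ → ℝ) : Prop :=
  S 0 = x₀ ∧ ∀ t, 0 ≤ t → HasDerivWithinAt S (v (S t)) (Ici 0) t

/-- Forward solutions are unique for a Lipschitz speed. -/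
theorem IsForwardSolution.eq_of_lipschitz {v : ℝ → ℝ} {K : NNReal} (hv : LipschitzWith K v) {x₀ : ℝ} {S S' : ℝ → ℝ}
    (h : IsForwardSolution v x₀ S) (h' : IsForwardSolution v x₀ S') {t : ℝ} (ht : 0 ≤ t) :
    S t = S' t := by
  have key := ODE_solution_unique_of_mem_Icc_right (v := fun _ => v) (s := fun _ => univ) (K := K)
    (f := S) (g := S') (a := 0) (b := t) (fun _ _ => hv.lipschitzOnWith)
    (fun s hs => ((h.2 s hs.1).continuousWithinAt).mono (fun r hr => hr.1))
    (fun s hs => (h.2 s hs.1).mono (fun r hr => le_trans hs.1 hr)) (fun _ _ => mem_univ _)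
    (fun s hs => ((h'.2 s hs.1).continuousWithinAt).mono (fun r hr => hr.1))
    (fun s hs => (h'.2 s hs.1).mono (fun r hr => le_trans hs.1 hr)) (fun _ _ => mem_univ _)
    (h.1.trans h'.1.symm)
  exact key ⟨ht, le_rfl⟩

theorem exists_local_solution {v : ℝ → ℝ} {K : NNReal} (hv : LipschitzWith K v) (x : ℝ) :
    ∃ S : ℝ → ℝ, S 0 = x ∧ ∀ t ∈ Icc (0 : ℝ) (1 / (2 * (K + 1))),
      HasDerivWithinAt S (v (S t)) (Icc 0 (1 / (2 * ((K : ℝ) + 1)))) t := by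
  have hK : (0 : ℝ) ≤ K := K.2
  have hh : (0 : ℝ) ≤ 1 / (2 * ((K : ℝ) + 1)) := by positivity
  have hp : IsPicardLindelof (fun _ => v) (tmin := 0) (tmax := 1 / (2 * ((K : ℝ) + 1)))
      ⟨0, le_rfl, hh⟩ x (‖v x‖₊ + 1) 0 (‖v x‖₊ + K * (‖v x‖₊ + 1)) K := by
    apply IsPicardLindelof.of_time_independent
    · intro y hy
      have h1 : |v y - v x| ≤ K * |y - x| := by
        simpa [Real.dist_eq] using hv.dist_le_mul y x
      have h2 : |y - x| ≤ |v x| + 1 := by simpa [Real.dist_eq] using hy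
      have h3 : |v y| ≤ |v x| + |v y - v x| := by
        have := abs_add_le (v x) (v y - v x); simpa using this
      have h4 := mul_le_mul_of_nonneg_left h2 hK
      simp only [Real.norm_eq_abs, NNReal.coe_add, NNReal.coe_mul, coe_nnnorm, NNReal.coe_one]
      linarith
    · exact hv.lipschitzOnWith
    · have h0 : 0 ≤ |v x| := abs_nonneg _
      simp only [NNReal.coe_add, NNReal.coe_mul, coe_nnnorm, NNReal.coe_one, Real.norm_eq_abs,
        sub_zero, sub_self, NNReal.coe_zero, max_eq_left hh]
      rw [mul_one_div, div_le_iff₀ (by positivity)]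
      nlinarith
  obtain ⟨S, hS, hS'⟩ := hp.exists_eq_forall_mem_Icc_hasDerivWithinAt₀
  exact ⟨S, hS, hS'⟩

theorem exists_solution_Icc {v : ℝ → ℝ} {K : NNReal} (hv : LipschitzWith K v) (x : ℝ) (n : ℕ) :
    ∃ S : ℝ → ℝ, S 0 = x ∧ ∀ t ∈ Icc (0 : ℝ) (n * (1 / (2 * (K + 1)))),
      HasDerivWithinAt S (v (S t)) (Icc 0 (n * (1 / (2 * ((K : ℝ) + 1))))) t := by
  have hK : (0 : ℝ) ≤ K := K.2
  have hh : (0 : ℝ) < 1 / (2 * ((K : ℝ) + 1)) := by positivity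
  induction n with
  | zero =>
    refine ⟨fun _ => x, rfl, fun t ht => ?_⟩
    simp only [Nat.cast_zero, zero_mul, Icc_self]
    simp only [Nat.cast_zero, zero_mul, Icc_self, mem_singleton_iff] at ht
    subst ht
    exact hasDerivWithinAt_iff_hasFDerivWithinAt.2 (.of_subsingleton (by simp))
  | succ n ih =>
    obtain ⟨S, hS0, hS⟩ := ih
    obtain ⟨R, hR0, hR⟩ := exists_local_solution hv (S (n * (1 / (2 * ((K : ℝ) + 1)))))
    set h : ℝ := 1 / (2 * ((K : ℝ) + 1)) with hh_def
    set T : ℝ := n * h with hT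
    have hT0 : 0 ≤ T := by positivity
    have hT1 : ((n + 1 : ℕ) : ℝ) * h = T + h := by push_cast; ring
    rw [hT1]
    let U : ℝ → ℝ := fun t => if t ≤ T then S t else R (t - T)
    have hUS : ∀ t, t ≤ T → U t = S t := fun t ht => if_pos ht
    have hUR : ∀ t, T ≤ t → U t = R (t - T) := fun t ht => by
      rcases ht.eq_or_lt with rfl | h'
      · rw [hUS _ le_rfl, sub_self, hR0]
      · exact if_neg (not_le.2 h')
    have dS : ∀ t ∈ Icc 0 T, HasDerivWithinAt U (v (U t)) (Icc 0 T) t := fun t ht => by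
      rw [hUS t ht.2]
      exact (hS t ht).congr (fun s hs => hUS s hs.2) (hUS t ht.2)
    have dR : ∀ t ∈ Icc T (T + h), HasDerivWithinAt U (v (U t)) (Icc T (T + h)) t := fun t ht => by
      rw [hUR t ht.1]
      have h1 := hR (t - T) ⟨by linarith [ht.1], by linarith [ht.2]⟩
      have h2 : HasDerivWithinAt (fun s => s - T) 1 (Icc T (T + h)) t :=
        ((hasDerivAt_id t).sub_const T).hasDerivWithinAt
      have h3 := HasDerivWithinAt.scomp t h1 h2
        (fun s (hs : s ∈ Icc T (T + h)) => show s - T ∈ Icc 0 h from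
          ⟨by linarith [hs.1], by linarith [hs.2]⟩)
      rw [one_smul] at h3
      exact h3.congr (fun s hs => hUR s hs.1) (hUR t ht.1)
    refine ⟨U, (hUS 0 hT0).trans hS0, fun t ht => ?_⟩
    have hun : Icc 0 T ∪ Icc T (T + h) = Icc 0 (T + h) :=
      Icc_union_Icc_eq_Icc hT0 (by linarith)
    rw [← hun]
    rcases lt_trichotomy t T with hlt | heq | hgt
    · refine (dS t ⟨ht.1, hlt.le⟩).union ?_
      refine hasDerivWithinAt_iff_hasFDerivWithinAt.2 (HasFDerivWithinAt.of_notMem_closure ?_)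
      rw [closure_Icc]; exact fun hc => absurd hc.1 (not_le.2 hlt)
    · exact (dS t ⟨ht.1, heq.le⟩).union (dR t ⟨heq.ge, ht.2⟩)
    · refine HasDerivWithinAt.union ?_ (dR t ⟨hgt.le, ht.2⟩)
      refine hasDerivWithinAt_iff_hasFDerivWithinAt.2 (HasFDerivWithinAt.of_notMem_closure ?_)
      rw [closure_Icc]; exact fun hc => absurd hc.2 (not_le.2 hgt)

/-- Forward solutions exist, for all times, for a Lipschitz speed. -/
theorem exists_isForwardSolution {v : ℝ → ℝ} {K : NNReal} (hv : LipschitzWith K v) (x₀ : ℝ) :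
    ∃ S, IsForwardSolution v x₀ S := by
  have hK : (0 : ℝ) ≤ K := K.2
  choose α hα0 hα using exists_solution_Icc hv x₀
  set h : ℝ := 1 / (2 * ((K : ℝ) + 1)) with hh_def
  have hh : 0 < h := by positivity
  have agree : ∀ m n : ℕ, ∀ t, 0 ≤ t → t ≤ m * h → t ≤ n * h → α m t = α n t := by
    intro m n t ht hm hn
    have side : ∀ k : ℕ, t ≤ k * h → ContinuousOn (α k) (Icc 0 t) ∧
        ∀ s ∈ Ico 0 t, HasDerivWithinAt (α k) (v (α k s)) (Ici s) s := by
      intro k hk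
      refine ⟨fun s hs => ((hα k s ⟨hs.1, hs.2.trans hk⟩).continuousWithinAt).mono
        (Icc_subset_Icc_right hk), fun s hs => ?_⟩
      refine (hα k s ⟨hs.1, hs.2.le.trans hk⟩).mono_of_mem_nhdsWithin ?_
      exact mem_of_superset (Icc_mem_nhdsGE (hs.2.trans_le hk)) (Icc_subset_Icc_left hs.1)
    exact ODE_solution_unique_of_mem_Icc_right (v := fun _ => v) (s := fun _ => univ) (K := K)
      (fun _ _ => hv.lipschitzOnWith) (side m hm).1 (side m hm).2 (fun _ _ => mem_univ _)
      (side n hn).1 (side n hn).2 (fun _ _ => mem_univ _)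
      ((hα0 m).trans (hα0 n).symm) ⟨ht, le_rfl⟩
  have hceil : ∀ t : ℝ, t ≤ (⌈t / h⌉₊ : ℝ) * h := fun t => (div_le_iff₀ hh).1 (Nat.le_ceil _)
  let S : ℝ → ℝ := fun t => α ⌈t / h⌉₊ t
  refine ⟨S, hα0 _, fun t ht => ?_⟩
  have hlt : t < ((⌈t / h⌉₊ + 1 : ℕ) : ℝ) * h := by
    push_cast; nlinarith [hceil t]
  have hSeq : ∀ s ∈ Icc 0 (((⌈t / h⌉₊ + 1 : ℕ) : ℝ) * h), S s = α (⌈t / h⌉₊ + 1) s :=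
    fun s hs => agree _ _ s hs.1 (hceil s) hs.2
  have hd := hα (⌈t / h⌉₊ + 1) t ⟨ht, hlt.le⟩
  rw [← hSeq t ⟨ht, hlt.le⟩] at hd
  refine (hd.congr hSeq (hSeq t ⟨ht, hlt.le⟩)).mono_of_mem_nhdsWithin ?_
  have : Iio (((⌈t / h⌉₊ + 1 : ℕ) : ℝ) * h) ∈ 𝓝[Ici 0] t :=
    mem_nhdsWithin_of_mem_nhds (Iio_mem_nhds hlt)
  filter_upwards [this, self_mem_nhdsWithin] with s hs hs'
  exact ⟨hs', le_of_lt hs⟩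

/-- The solution of `S' = v(S)`, `S(0) = x₀`, on `[0, ∞)`; for a Lipschitz speed `v` it exists and
is unique on `[0, ∞)`. (Its values at negative times mean nothing and are never used.) -/
noncomputable def odeSolution (v : ℝ → ℝ) (x₀ : ℝ) : ℝ → ℝ :=
  Classical.epsilon (IsForwardSolution v x₀)

theorem odeSolution_spec {v : ℝ → ℝ} {K : NNReal} (hv : LipschitzWith K v) (x₀ : ℝ) :
    IsForwardSolution v x₀ (odeSolution v x₀) :=
  Classical.epsilon_spec (exists_isForwardSolution hv x₀)

section Front

variable {Ω : Type*} [MeasurableSpace Ω] (P : Measure Ω) (a b g : ℝ → Ω → ℝ) (q : ℝ)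

/-- The effective interior coefficient `ā`, given by `1 / ā = E[1 / a(0, ·)]`. -/
noncomputable def effectiveCoefficient : ℝ := (∫ ω, (a 0 ω)⁻¹ ∂P)⁻¹

/-- The speed `q b(x, ω) μ(x, ω) + g(x, ω)` of the front, where `μ(x, ω) = ā / a(x, ω)`. -/
noncomputable def frontSpeed (ω : Ω) (x : ℝ) : ℝ :=
  q * b x ω * (effectiveCoefficient P a / a x ω) + g x ω

/-- The position `S_q^{x₀}(t, ω)` of the front that starts from `x₀`. -/
noncomputable def front (x₀ t : ℝ) (ω : Ω) : ℝ :=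
  odeSolution (frontSpeed P a b g q ω) x₀ t

/-- The rescaled front `S_{q,ε}^{x₀}(t, ω) = ε (S_q^{x₀}(t / ε, ω) - x₀) + x₀`. -/
noncomputable def rescaledFront (ε x₀ t : ℝ) (ω : Ω) : ℝ :=
  ε * (front P a b g q x₀ (ε⁻¹ * t) ω - x₀) + x₀

/-- The arrival time `T_q(x₁; x₀, ω)` at `x₁ > x₀` of the front that starts from `x₀`. -/
noncomputable def arrivalTime (x₁ x₀ : ℝ) (ω : Ω) : ℝ :=
  sInf {t : ℝ | 0 < t ∧ front P a b g q x₀ t ω = x₁}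

/-- `T` is the effective arrival time: for every `x₀`, almost surely
`T_q(x₀ + r; x₀, ω) / r → T` as `r → ∞`. -/
def IsEffectiveArrivalTime (T : ℝ) : Prop :=
  ∀ x₀ : ℝ, ∀ᵐ ω ∂P,
    Tendsto (fun r : ℝ => arrivalTime P a b g q (x₀ + r) x₀ ω / r) atTop (𝓝 T)

/-- `V` is the effective velocity: the inverse of the (positive) effective arrival time. -/
def IsEffectiveVelocity (V : ℝ) : Prop :=
  ∃ T : ℝ, 0 < T ∧ IsEffectiveArrivalTime P a b g q T ∧ V = 1 / T

end Front

end FrontODE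

open FrontODE

/-! The speed is bounded below by a positive constant, so a solution can be inverted: the time
needed to reach `x₁` from `x₀` is the integral of the slowness `1 / v` over `[x₀, x₁]`
(`IsForwardSolution.integral_inv_eq`). The slowness is a bounded stationary field, so the ergodic
theorem gives almost surely `∫₀ˣ 1 / v = T x + o(|x|)` as `x → ±∞`, where `T` is its mean over a
unit interval (`ae_abs_integral_sub_le`). This is the effective arrival time.

Uniformity in the shift comes from working in a single medium: the front in `τ y ω` started at `x₀`
is, moved by `y`, the front in `ω` started at `x₀ + y`. For `|y| ≤ Λ / ε` and times of order `1 / ε`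
all endpoints lie at distance `O(1 / ε)` from the origin, so the sublinear error is `o(1 / ε)`
uniformly and vanishes after multiplication by `ε` (`ae_tendsto_rescaledFront`).

The ergodic theorem is derived from the maximal inequality for the single map `τ 1`, which need not
be ergodic. Ergodicity of the whole group enters through the event that the upper limit of the
averages is at most `c`: it is invariant under every `τ y`. -/

namespace FrontODE

/-! ### Maximal ergodic theorem and invariant events. -/

section Ergodic

variable {Ω : Type*}

/-- The maximum of `0` and of the first `n` Birkhoff sums of `f` along `T`. -/
noncomputable def maxBirkhoffSum (T : Ω → Ω) (f : Ω → ℝ) : ℕ → Ω → ℝ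
  | 0, _ => 0
  | n + 1, ω => max 0 (f ω + maxBirkhoffSum T f n (T ω))

theorem maxBirkhoffSum_nonneg (T : Ω → Ω) (f : Ω → ℝ) (n : ℕ) (ω : Ω) :
    0 ≤ maxBirkhoffSum T f n ω := by
  cases n with
  | zero => exact le_rfl
  | succ n => exact le_max_left _ _

theorem maxBirkhoffSum_le_succ (T : Ω → Ω) (f : Ω → ℝ) (n : ℕ) (ω : Ω) :
    maxBirkhoffSum T f n ω ≤ maxBirkhoffSum T f (n + 1) ω := by
  induction n generalizing ω with
  | zero => exact le_max_left _ _
  | succ n ih => exact max_le_max le_rfl (add_le_add le_rfl (ih (T ω)))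

theorem maxBirkhoffSum_mono (T : Ω → Ω) (f : Ω → ℝ) (ω : Ω) :
    Monotone fun n => maxBirkhoffSum T f n ω :=
  monotone_nat_of_le_succ fun n => maxBirkhoffSum_le_succ T f n ω

theorem birkhoffSum_le_maxBirkhoffSum (T : Ω → Ω) (f : Ω → ℝ) (n : ℕ) (ω : Ω) :
    birkhoffSum T f n ω ≤ maxBirkhoffSum T f n ω := by
  induction n generalizing ω with
  | zero => simp [maxBirkhoffSum]
  | succ n ih =>
    rw [birkhoffSum_succ']
    exact (add_le_add le_rfl (ih (T ω))).trans (le_max_right _ _)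

variable [MeasurableSpace Ω] {P : Measure Ω}

theorem integrable_maxBirkhoffSum {T : Ω → Ω} (hT : MeasurePreserving T P P) {f : Ω → ℝ}
    (hf : Integrable f P) (n : ℕ) : Integrable (maxBirkhoffSum T f n) P := by
  induction n with
  | zero => exact integrable_zero _ _ _
  | succ n ih =>
    exact (integrable_zero Ω ℝ P).sup (hf.add (hT.integrable_comp_of_integrable ih))

theorem measurable_maxBirkhoffSum {T : Ω → Ω} (hT : Measurable T) {f : Ω → ℝ}
    (hf : Measurable f) (n : ℕ) : Measurable (maxBirkhoffSum T f n) := by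
  induction n with
  | zero => exact measurable_const
  | succ n ih => exact measurable_const.max (hf.add (ih.comp hT))

/-- The maximal ergodic theorem. -/
theorem integral_nonneg_of_exists_birkhoffSum_pos {T : Ω → Ω} (hT : MeasurePreserving T P P)
    {f : Ω → ℝ} (hfm : Measurable f) (hf : Integrable f P)
    (h : ∀ᵐ ω ∂P, ∃ n, 0 < birkhoffSum T f n ω) : 0 ≤ ∫ ω, f ω ∂P := by
  let A : ℕ → Set Ω := fun n => {ω | 0 < maxBirkhoffSum T f (n + 1) ω}
  have hA : ∀ n, MeasurableSet (A n) := fun n =>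
    measurableSet_lt measurable_const (measurable_maxBirkhoffSum hT.measurable hfm _)
  have hpos : ∀ n, 0 ≤ ∫ ω, (A n).indicator f ω ∂P := by
    intro n
    have hi := integrable_maxBirkhoffSum hT hf (n + 1)
    have hi' : Integrable (fun ω => maxBirkhoffSum T f (n + 1) (T ω)) P :=
      hT.integrable_comp_of_integrable hi
    -- With `M` the maximum at rank `n + 1`: on `A n`, `M ≤ f + M ∘ T`; off `A n`, `M = 0 ≤ M ∘ T`.
    -- Hence `M - M ∘ T ≤ 1_{A n} f`, and the left side has integral zero.
    have h0 : ∫ ω, (maxBirkhoffSum T f (n + 1) ω - maxBirkhoffSum T f (n + 1) (T ω)) ∂P = 0 := by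
      rw [integral_sub hi hi', sub_eq_zero]
      have := integral_map (μ := P) hT.measurable.aemeasurable
        (f := maxBirkhoffSum T f (n + 1)) (by rw [hT.map_eq]; exact hi.aestronglyMeasurable)
      rwa [hT.map_eq] at this
    rw [← h0]
    refine integral_mono (hi.sub hi') (hf.indicator (hA n)) fun ω => ?_
    by_cases hω : ω ∈ A n
    · rw [indicator_of_mem hω]
      have h1 : maxBirkhoffSum T f (n + 1) ω = f ω + maxBirkhoffSum T f n (T ω) := by
        have h2 : 0 < max 0 (f ω + maxBirkhoffSum T f n (T ω)) := hω
        exact max_eq_right ((lt_max_iff.1 h2).resolve_left (lt_irrefl _)).le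
      have := maxBirkhoffSum_le_succ T f n (T ω)
      simp only
      linarith
    · rw [indicator_of_notMem hω]
      have h1 : maxBirkhoffSum T f (n + 1) ω ≤ 0 := not_lt.1 hω
      have := maxBirkhoffSum_nonneg T f (n + 1) (T ω)
      simp only
      linarith
  -- The sets `A n` increase to a set of full measure, by `h`.
  refine ge_of_tendsto' (tendsto_integral_of_dominated_convergence (fun ω => |f ω|)
    (fun n => (hfm.indicator (hA n)).aestronglyMeasurable) hf.abs (fun n => ?_) ?_) hpos
  · exact Eventually.of_forall fun ω => norm_indicator_le_norm_self f ω
  · filter_upwards [h] with ω ⟨n, hn⟩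
    refine tendsto_const_nhds.congr' ?_
    filter_upwards [eventually_ge_atTop n] with N hN
    refine (indicator_of_mem ?_ f).symm
    exact (hn.trans_le (birkhoffSum_le_maxBirkhoffSum T f n ω)).trans_le
      (maxBirkhoffSum_mono T f ω (by omega))

variable {τ : ℝ → Ω → Ω}

theorem IsErgodicGroup.reflect (hτ : IsErgodicGroup P τ) :
    IsErgodicGroup P fun y => τ (-y) where
  measurePreserving y := hτ.measurePreserving (-y)
  zero ω := by simpa using hτ.zero ω
  add y z ω := by rw [hτ.add]; congr 1; ring
  ergodic E hE h := hτ.ergodic E hE fun y => by simpa using h (-y)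

theorem IsErgodicGroup.iterate (hτ : IsErgodicGroup P τ) (n : ℕ) (ω : Ω) :
    (τ 1)^[n] ω = τ n ω := by
  induction n with
  | zero => simp [hτ.zero]
  | succ n ih => rw [Function.iterate_succ_apply', ih, hτ.add]; push_cast; congr 1; ring

/-- Stability under `τ (-y)` gives the reverse inclusion for `τ y`. -/
theorem IsErgodicGroup.zero_or_one (hτ : IsErgodicGroup P τ) {E : Set Ω} (hE : MeasurableSet E)
    (h : ∀ y, ∀ ω ∈ E, τ y ω ∈ E) : P E = 0 ∨ P E = 1 := by
  refine hτ.ergodic E hE fun y => Subset.antisymm ?_ fun ω hω => ?_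
  · rintro _ ⟨ω, hω, rfl⟩
    exact h y ω hω
  · exact ⟨τ (-y) ω, h _ _ hω, by rw [hτ.add, add_neg_cancel, hτ.zero]⟩

/-! ### Ergodic theorem for bounded stationary fields. -/

/-- A stationary field which is continuous in space and bounded. -/
structure IsBoundedField (τ : ℝ → Ω → Ω) (φ : ℝ → Ω → ℝ) (M : ℝ) : Prop where
  stationary : IsStationaryField τ φ
  continuous : ∀ ω, Continuous fun x => φ x ω
  bound : ∀ x ω, |φ x ω| ≤ M

namespace IsBoundedField

variable {φ : ℝ → Ω → ℝ} {M : ℝ}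

theorem neg (h : IsBoundedField τ φ M) : IsBoundedField τ (fun x ω => -φ x ω) M where
  stationary := ⟨fun x => (h.stationary.measurable x).neg,
    fun y z ω => congrArg Neg.neg (h.stationary.stationary y z ω)⟩
  continuous ω := (h.continuous ω).neg
  bound x ω := by rw [abs_neg]; exact h.bound x ω

theorem reflect (h : IsBoundedField τ φ M) :
    IsBoundedField (fun y => τ (-y)) (fun x ω => φ (-x) ω) M where
  stationary := ⟨fun x => h.stationary.measurable (-x), fun y z ω => by
    rw [← h.stationary.stationary, neg_add]⟩
  continuous ω := (h.continuous ω).comp continuous_neg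
  bound x ω := h.bound (-x) ω

theorem intervalIntegrable (h : IsBoundedField τ φ M) (s t : ℝ) (ω : Ω) :
    IntervalIntegrable (fun x => φ x ω) volume s t :=
  (h.continuous ω).intervalIntegrable s t

theorem abs_integral_le (h : IsBoundedField τ φ M) (s t : ℝ) (ω : Ω) :
    |∫ x in s..t, φ x ω| ≤ M * |t - s| :=
  (Real.norm_eq_abs _).symm.trans_le
    (intervalIntegral.norm_integral_le_of_norm_le_const fun x _ => h.bound x ω)

theorem integral_shift (h : IsBoundedField τ φ M) (s t y : ℝ) (ω : Ω) :
    ∫ x in s..t, φ x (τ y ω) = ∫ x in s + y..t + y, φ x ω := by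
  rw [← intervalIntegral.integral_comp_add_right (fun x => φ x ω)]
  simp only [h.stationary.stationary]

/-- Continuity in space and measurability in `ω` give joint measurability. -/
theorem measurable_integral (h : IsBoundedField τ φ M) (s t : ℝ) :
    Measurable fun ω => ∫ x in s..t, φ x ω := by
  have hm : Measurable (Function.uncurry fun ω x => φ x ω) :=
    (measurable_uncurry_of_continuous_of_measurable h.continuous
      h.stationary.measurable).comp measurable_swap
  simp only [intervalIntegral]
  exact (hm.stronglyMeasurable.integral_prod_right (ν := volume.restrict (Ioc s t))).measurable.sub
    (hm.stronglyMeasurable.integral_prod_right (ν := volume.restrict (Ioc t s))).measurable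

theorem integrable_integral [IsFiniteMeasure P] (h : IsBoundedField τ φ M) (s t : ℝ) :
    Integrable (fun ω => ∫ x in s..t, φ x ω) P :=
  Integrable.of_bound (h.measurable_integral s t).aestronglyMeasurable (M * |t - s|)
    (Eventually.of_forall fun ω => h.abs_integral_le s t ω)

theorem birkhoffSum_eq (h : IsBoundedField τ φ M) (hτ : IsErgodicGroup P τ) (c : ℝ) (n : ℕ)
    (ω : Ω) : birkhoffSum (τ 1) (fun ω => (∫ x in (0 : ℝ)..1, φ x ω) - c) n ω =
      (∫ x in (0 : ℝ)..n, φ x ω) - c * n := by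
  induction n with
  | zero => simp
  | succ n ih =>
    rw [birkhoffSum_succ, ih, hτ.iterate, h.integral_shift, zero_add,
      ← intervalIntegral.integral_add_adjacent_intervals (h.intervalIntegrable 0 n ω)
        (h.intervalIntegrable n (n + 1 : ℕ) ω)]
    push_cast
    rw [add_comm (1 : ℝ)]
    ring

/-- The two domains of integration differ by two intervals of length `|y|`. The bound does not
depend on `t`, so averages over long intervals have shift-invariant limits. -/
theorem abs_integral_shift_sub_le (h : IsBoundedField τ φ M) (t y : ℝ) (ω : Ω) :
    |(∫ x in (0 : ℝ)..t, φ x (τ y ω)) - ∫ x in (0 : ℝ)..t, φ x ω| ≤ 2 * M * |y| := by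
  rw [h.integral_shift, zero_add,
    intervalIntegral.integral_interval_sub_interval_comm (h.intervalIntegrable _ _ ω)
      (h.intervalIntegrable _ _ ω) (h.intervalIntegrable _ _ ω)]
  have h1 := h.abs_integral_le y 0 ω
  have h2 := h.abs_integral_le (t + y) t ω
  simp only [zero_sub, abs_neg, sub_add_cancel_left] at h1 h2
  have h3 := abs_sub (∫ x in y..0, φ x ω) (∫ x in t + y..t, φ x ω)
  linarith

theorem bound_nonneg (h : IsBoundedField τ φ M) (ω : Ω) : 0 ≤ M :=
  (abs_nonneg _).trans (h.bound 0 ω)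

/-- The upper half of the pointwise ergodic theorem. -/
theorem ae_eventually_integral_le [IsProbabilityMeasure P] (h : IsBoundedField τ φ M)
    (hτ : IsErgodicGroup P τ) {c : ℝ} (hc : ∫ ω, (∫ x in (0 : ℝ)..1, φ x ω) ∂P < c) :
    ∀ᵐ ω ∂P, ∀ k : ℕ, ∀ᶠ n : ℕ in atTop,
      (∫ x in (0 : ℝ)..n, φ x ω) ≤ (c + 1 / (k + 1)) * n := by
  set E : Set Ω := {ω | ∀ k : ℕ, ∀ᶠ n : ℕ in atTop,
      (∫ x in (0 : ℝ)..n, φ x ω) ≤ (c + 1 / (k + 1)) * n} with hE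
  have hEm : MeasurableSet E := by
    have : E = ⋂ k : ℕ, ⋃ N : ℕ, ⋂ n : ℕ, ⋂ _ : N ≤ n,
        {ω | (∫ x in (0 : ℝ)..n, φ x ω) ≤ (c + 1 / (k + 1)) * n} := by
      ext ω; simp [hE, eventually_atTop]
    rw [this]
    exact .iInter fun k => .iUnion fun N => .iInter fun n => .iInter fun _ =>
      measurableSet_le (h.measurable_integral 0 n) measurable_const
  have hinv : ∀ y, ∀ ω ∈ E, τ y ω ∈ E := by
    intro y ω hω k
    -- The cost `2 * M * |y|` of the shift is absorbed, for large `n`, by the gap between the slacks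
    -- of ranks `k` and `k + 1`.
    have hδ : (0 : ℝ) < 1 / (k + 1) - 1 / (k + 2) := by
      rw [sub_pos]; exact one_div_lt_one_div_of_lt (by positivity) (by linarith)
    filter_upwards [hω (k + 1), eventually_ge_atTop
      ⌈2 * M * |y| / (1 / (k + 1) - 1 / (k + 2))⌉₊] with n hn hn'
    have h1 := (div_le_iff₀ hδ).1 ((Nat.le_ceil _).trans (Nat.cast_le.2 hn'))
    have h2 := (abs_le.1 (h.abs_integral_shift_sub_le n y ω)).2
    have h3 : ((k + 1 : ℕ) : ℝ) + 1 = k + 2 := by push_cast; ring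
    rw [h3] at hn
    linarith
  rcases hτ.zero_or_one hEm hinv with h0 | h1
  -- If `E` were null, almost every `ω` would have a positive Birkhoff sum of `f - c`, and the
  -- maximal theorem would force the mean to be at least `c`.
  · exfalso
    have hi : Integrable (fun ω => ∫ x in (0 : ℝ)..1, φ x ω) P := h.integrable_integral 0 1
    have key := integral_nonneg_of_exists_birkhoffSum_pos (hτ.measurePreserving 1)
      (f := fun ω => (∫ x in (0 : ℝ)..1, φ x ω) - c)
      ((h.measurable_integral 0 1).sub_const c) (hi.sub (integrable_const c)) (by
        have h0' : ∀ᵐ ω ∂P, ω ∉ E := measure_eq_zero_iff_ae_notMem.1 h0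
        filter_upwards [h0'] with ω hω
        simp only [hE, mem_ofPred_eq, not_forall, not_eventually, not_le] at hω
        obtain ⟨k, hk⟩ := hω
        obtain ⟨n, hn⟩ := hk.exists
        refine ⟨n, ?_⟩
        rw [h.birkhoffSum_eq hτ]
        have : (0 : ℝ) ≤ 1 / (k + 1) * n := by positivity
        linarith)
    rw [integral_sub hi (integrable_const c)] at key
    simp at key
    linarith
  · exact (mem_ae_iff_prob_eq_one hEm).2 h1

theorem ae_integral_le [IsProbabilityMeasure P] (h : IsBoundedField τ φ M)
    (hτ : IsErgodicGroup P τ) :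
    ∀ᵐ ω ∂P, ∀ δ > 0, ∃ C, ∀ x, 0 ≤ x → (∫ z in (0 : ℝ)..x, φ z ω) ≤
      ((∫ ω, (∫ z in (0 : ℝ)..1, φ z ω) ∂P) + δ) * x + C := by
  set m := ∫ ω, (∫ z in (0 : ℝ)..1, φ z ω) ∂P with hm
  have key : ∀ᵐ ω ∂P, ∀ j k : ℕ, ∀ᶠ n : ℕ in atTop,
      (∫ x in (0 : ℝ)..n, φ x ω) ≤ (m + 1 / (j + 1) + 1 / (k + 1)) * n :=
    ae_all_iff.2 fun j => h.ae_eventually_integral_le hτ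
      (lt_add_of_pos_right _ (by positivity))
  filter_upwards [key] with ω hω δ hδ
  obtain ⟨k, hk⟩ := exists_nat_one_div_lt (half_pos hδ)
  obtain ⟨N, hN⟩ := eventually_atTop.1 (hω k k)
  have hM := h.bound_nonneg ω
  -- The term with `N` covers `x ≤ N` by the crude bound; the additional `1` covers rounding `x`
  -- down to an integer.
  refine ⟨(M + |m + δ|) * (N + 1), fun x hx => ?_⟩
  have hab := abs_nonneg (m + δ)
  have hN0 : (0 : ℝ) ≤ N := N.cast_nonneg
  rcases le_total (N : ℝ) x with hNx | hNx
  · have hn := hN ⌊x⌋₊ (Nat.le_floor hNx)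
    have h1 := Nat.floor_le hx
    have h2 := (Nat.lt_floor_add_one x).le
    have h3 := (abs_le.1 (h.abs_integral_le ⌊x⌋₊ x ω)).2
    rw [abs_of_nonneg (by linarith)] at h3
    rw [← intervalIntegral.integral_add_adjacent_intervals (h.intervalIntegrable 0 ⌊x⌋₊ ω)
        (h.intervalIntegrable ⌊x⌋₊ x ω)]
    have h4 : M * (x - ⌊x⌋₊) ≤ M := mul_le_of_le_one_right hM (by linarith)
    have h5 : (m + 1 / (k + 1) + 1 / (k + 1)) * ⌊x⌋₊ ≤ (m + δ) * ⌊x⌋₊ :=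
      mul_le_mul_of_nonneg_right (by linarith) (Nat.cast_nonneg _)
    have h6 : (m + δ) * (⌊x⌋₊ - x) ≤ |m + δ| := by
      refine (le_abs_self _).trans ?_
      rw [abs_mul]
      exact mul_le_of_le_one_right hab (abs_le.2 ⟨by linarith, by linarith⟩)
    nlinarith [mul_nonneg hM hN0, mul_nonneg hab hN0]
  · have h3 := (abs_le.1 (h.abs_integral_le 0 x ω)).2
    rw [sub_zero, abs_of_nonneg hx] at h3
    have h4 := mul_le_mul_of_nonneg_right (neg_abs_le (m + δ)) hx
    nlinarith [mul_le_mul_of_nonneg_left hNx hM, mul_le_mul_of_nonneg_left hNx hab]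

/-- The reflected integral runs over `[-1, 0]`, which `τ (-1)` carries to `[0, 1]` without changing
the law. -/
theorem expectation_reflect (h : IsBoundedField τ φ M) (hτ : IsErgodicGroup P τ) :
    ∫ ω, (∫ z in (0 : ℝ)..1, φ (-z) ω) ∂P = ∫ ω, (∫ z in (0 : ℝ)..1, φ z ω) ∂P := by
  have h1 : ∀ ω, ∫ z in (0 : ℝ)..1, φ (-z) ω = ∫ z in (0 : ℝ)..1, φ z (τ (-1) ω) := by
    intro ω
    rw [h.integral_shift, intervalIntegral.integral_comp_neg (fun z => φ z ω)]
    norm_num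
  simp only [h1]
  have hT := hτ.measurePreserving (-1)
  have := integral_map (μ := P) hT.measurable.aemeasurable
    (f := fun ω => ∫ z in (0 : ℝ)..1, φ z ω) (h.measurable_integral 0 1).aestronglyMeasurable
  rw [hT.map_eq] at this
  exact this.symm

/-- The pointwise ergodic theorem for a bounded stationary field, in both directions. -/
theorem ae_abs_integral_sub_le [IsProbabilityMeasure P] (h : IsBoundedField τ φ M)
    (hτ : IsErgodicGroup P τ) :
    ∀ᵐ ω ∂P, ∀ δ > 0, ∃ C, ∀ x, |(∫ z in (0 : ℝ)..x, φ z ω) -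
      (∫ ω, (∫ z in (0 : ℝ)..1, φ z ω) ∂P) * x| ≤ δ * |x| + C := by
  have hr := h.expectation_reflect hτ
  -- Upper and lower bounds on the right half-line, then on the left one through the reversed group.
  filter_upwards [h.ae_integral_le hτ, h.neg.ae_integral_le hτ,
    h.reflect.ae_integral_le hτ.reflect, h.reflect.neg.ae_integral_le hτ.reflect]
    with ω h1 h2 h3 h4 δ hδ
  obtain ⟨C₁, h1⟩ := h1 δ hδ
  obtain ⟨C₂, h2⟩ := h2 δ hδ
  obtain ⟨C₃, h3⟩ := h3 δ hδ
  obtain ⟨C₄, h4⟩ := h4 δ hδ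
  simp only [intervalIntegral.integral_neg, integral_neg, hr] at h1 h2 h3 h4
  set m := ∫ ω, (∫ z in (0 : ℝ)..1, φ z ω) ∂P
  refine ⟨max (max C₁ C₂) (max C₃ C₄), fun x => ?_⟩
  have hC₁ : C₁ ≤ max (max C₁ C₂) (max C₃ C₄) := by simp
  have hC₂ : C₂ ≤ max (max C₁ C₂) (max C₃ C₄) := by simp
  have hC₃ : C₃ ≤ max (max C₁ C₂) (max C₃ C₄) := by simp
  have hC₄ : C₄ ≤ max (max C₁ C₂) (max C₃ C₄) := by simp
  rcases le_total 0 x with hx | hx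
  · have h1 := h1 x hx
    have h2 := h2 x hx
    rw [abs_of_nonneg hx, abs_le]
    constructor <;> linarith
  · have h3 := h3 (-x) (neg_nonneg.2 hx)
    have h4 := h4 (-x) (neg_nonneg.2 hx)
    rw [intervalIntegral.integral_comp_neg (fun z => φ z ω), neg_neg, neg_zero,
      intervalIntegral.integral_symm] at h3 h4
    rw [abs_of_nonpos hx, abs_le]
    constructor <;> linarith

end IsBoundedField

end Ergodic

/-! ### Travel times of autonomous equations. -/

section Travel

variable {v : ℝ → ℝ} {c x₀ : ℝ} {S : ℝ → ℝ}

/-- The travel time of a solution of `S' = v(S)` is the integral of the slowness `1 / v`. -/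
theorem IsForwardSolution.integral_inv_eq (h : IsForwardSolution v x₀ S) (hv : Continuous v)
    (hpos : ∀ x, 0 < v x) {t : ℝ} (ht : 0 ≤ t) : ∫ x in x₀..S t, (v x)⁻¹ = t := by
  have hc : Continuous fun x => (v x)⁻¹ := hv.inv₀ fun x => (hpos x).ne'
  have hF : ∀ x, HasDerivAt (fun u => ∫ z in x₀..u, (v z)⁻¹) (v x)⁻¹ x := fun x =>
    intervalIntegral.integral_hasDerivAt_right (hc.intervalIntegrable _ _)
      hc.aestronglyMeasurable.stronglyMeasurableAtFilter hc.continuousAt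
  -- Travel time minus elapsed time has zero derivative, by the chain rule.
  have hG : ∀ s, 0 ≤ s →
      HasDerivWithinAt (fun s => (∫ z in x₀..S s, (v z)⁻¹) - s) 0 (Ici 0) s := by
    intro s hs
    have h1 := ((hF (S s)).comp_hasDerivWithinAt s (h.2 s hs)).sub (hasDerivWithinAt_id s (Ici 0))
    rwa [inv_mul_cancel₀ (hpos _).ne', sub_self] at h1
  have key := constant_of_has_deriv_right_zero (a := 0) (b := t)
    (fun s hs => (hG s hs.1).continuousWithinAt.mono fun r hr => hr.1)
    (fun s hs => (hG s hs.1).mono fun r hr => le_trans hs.1 hr) t ⟨ht, le_rfl⟩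
  rw [h.1, intervalIntegral.integral_same] at key
  linarith

/-- The arrival set is a singleton. Any arrival time equals the integral; conversely, at that time
the solution must be at `x₁`, because the integral of a positive slowness determines its endpoint.
-/
theorem IsForwardSolution.sInf_arrival_eq (h : IsForwardSolution v x₀ S) (hv : Continuous v)
    (hpos : ∀ x, 0 < v x) {x₁ : ℝ} (hx : x₀ < x₁) :
    sInf {t : ℝ | 0 < t ∧ S t = x₁} = ∫ x in x₀..x₁, (v x)⁻¹ := by
  have hc : Continuous fun x => (v x)⁻¹ := hv.inv₀ fun x => (hpos x).ne'
  have hi : ∀ s t, IntervalIntegrable (fun x => (v x)⁻¹) volume s t := hc.intervalIntegrable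
  have hlt : ∀ s t, s < t → 0 < ∫ x in s..t, (v x)⁻¹ := fun s t hst =>
    intervalIntegral.intervalIntegral_pos_of_pos (hi s t) (fun x => inv_pos.2 (hpos x)) hst
  suffices {t : ℝ | 0 < t ∧ S t = x₁} = {∫ x in x₀..x₁, (v x)⁻¹} by rw [this, csInf_singleton]
  ext t
  constructor
  · rintro ⟨ht, rfl⟩
    exact (h.integral_inv_eq hv hpos ht.le).symm
  · rintro rfl
    have ht := hlt x₀ x₁ hx
    refine ⟨ht, ?_⟩
    have h1 := h.integral_inv_eq hv hpos ht.le
    set y := S (∫ x in x₀..x₁, (v x)⁻¹)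
    have h2 := intervalIntegral.integral_add_adjacent_intervals (hi x₀ x₁) (hi x₁ y)
    have h3 := intervalIntegral.integral_symm (μ := volume) (f := fun x => (v x)⁻¹) x₁ y
    rcases lt_trichotomy y x₁ with hy | hy | hy
    · have := hlt _ _ hy; linarith
    · exact hy
    · have := hlt _ _ hy; linarith

end Travel

/-! ### Lipschitz bounds for products and inverses. -/

section Lipschitz

variable {Ω : Type*}

theorem UniformlyLipschitz.mul {f f' : ℝ → Ω → ℝ} {B B' : ℝ} (h : UniformlyLipschitz f)
    (h' : UniformlyLipschitz f') (hB : ∀ x ω, |f x ω| ≤ B) (hB' : ∀ x ω, |f' x ω| ≤ B') :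
    UniformlyLipschitz fun x ω => f x ω * f' x ω := by
  obtain ⟨K, hK⟩ := h
  obtain ⟨K', hK'⟩ := h'
  refine ⟨B' * K + B * K', fun x y ω => ?_⟩
  have h1 : f x ω * f' x ω - f y ω * f' y ω =
      f' x ω * (f x ω - f y ω) + f y ω * (f' x ω - f' y ω) := by ring
  rw [h1]
  refine (abs_add_le _ _).trans ?_
  rw [abs_mul, abs_mul, add_mul, mul_assoc, mul_assoc]
  exact add_le_add
    (mul_le_mul (hB' x ω) (hK x y ω) (abs_nonneg _) ((abs_nonneg _).trans (hB' x ω)))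
    (mul_le_mul (hB y ω) (hK' x y ω) (abs_nonneg _) ((abs_nonneg _).trans (hB y ω)))

theorem UniformlyLipschitz.inv {f : ℝ → Ω → ℝ} (h : UniformlyLipschitz f) {c : ℝ} (hc : 0 < c)
    (hf : ∀ x ω, c ≤ f x ω) : UniformlyLipschitz fun x ω => (f x ω)⁻¹ := by
  obtain ⟨K, hK⟩ := h
  refine ⟨K / (c * c), fun x y ω => ?_⟩
  have hx := hc.trans_le (hf x ω)
  have hy := hc.trans_le (hf y ω)
  rw [inv_sub_inv hx.ne' hy.ne', abs_div, abs_of_pos (mul_pos hx hy), abs_sub_comm,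
    div_mul_eq_mul_div]
  exact div_le_div₀ ((abs_nonneg _).trans (hK x y ω)) (hK x y ω) (by positivity)
    (mul_le_mul (hf x ω) (hf y ω) hc.le hx.le)

theorem UniformlyPositiveFinite.exists_abs_le {f : ℝ → Ω → ℝ} (h : UniformlyPositiveFinite f) :
    ∃ B, ∀ x ω, |f x ω| ≤ B := by
  obtain ⟨c, C, hc, hf⟩ := h
  exact ⟨C, fun x ω => (abs_of_pos (hc.trans_le (hf x ω).1)).trans_le (hf x ω).2⟩

theorem UniformlyLipschitz.exists_lipschitzWith {f : ℝ → Ω → ℝ} (h : UniformlyLipschitz f) :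
    ∃ K : NNReal, ∀ ω, LipschitzWith K fun x => f x ω := by
  obtain ⟨K, hK⟩ := h
  refine ⟨K.toNNReal, fun ω => LipschitzWith.of_dist_le_mul fun x y => ?_⟩
  rw [Real.dist_eq, Real.dist_eq]
  exact (hK x y ω).trans (mul_le_mul_of_nonneg_right (Real.le_coe_toNNReal K) (abs_nonneg _))

end Lipschitz

/-! ### Speed and slowness of the front. -/

section Speed

variable {Ω : Type*} [MeasurableSpace Ω] {P : Measure Ω} {τ : ℝ → Ω → Ω} {a b g : ℝ → Ω → ℝ}
  {q : ℝ}

theorem effectiveCoefficient_pos [IsProbabilityMeasure P] (ha : UniformlyPositiveFinite a)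
    (hm : Measurable (a 0)) : 0 < effectiveCoefficient P a := by
  obtain ⟨c, C, hc, h⟩ := ha
  have hpos : ∀ ω, 0 < a 0 ω := fun ω => hc.trans_le (h 0 ω).1
  have hi : Integrable (fun ω => (a 0 ω)⁻¹) P := by
    refine Integrable.of_bound hm.inv.aestronglyMeasurable c⁻¹ (Eventually.of_forall fun ω => ?_)
    rw [Real.norm_of_nonneg (inv_pos.2 (hpos ω)).le]
    exact inv_anti₀ hc (h 0 ω).1
  refine inv_pos.2 ((integral_pos_iff_support_of_nonneg (fun ω => (inv_pos.2 (hpos ω)).le) hi).2 ?_)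
  have : Function.support (fun ω => (a 0 ω)⁻¹) = univ :=
    eq_univ_of_forall fun ω => (inv_pos.2 (hpos ω)).ne'
  simp [this]

theorem frontSpeed_shift (h : IsAdmissible τ a b g) (y x : ℝ) (ω : Ω) :
    frontSpeed P a b g q (τ y ω) x = frontSpeed P a b g q ω (x + y) := by
  simp only [frontSpeed, h.a_stationary.stationary, h.b_stationary.stationary,
    h.g_stationary.stationary]

theorem measurable_frontSpeed (h : IsAdmissible τ a b g) (x : ℝ) :
    Measurable fun ω => frontSpeed P a b g q ω x :=
  ((measurable_const.mul (h.b_stationary.measurable x)).mul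
    (measurable_const.div (h.a_stationary.measurable x))).add (h.g_stationary.measurable x)

theorem exists_le_frontSpeed [IsProbabilityMeasure P] (h : IsAdmissible τ a b g) (hq : 0 < q) :
    ∃ m, 0 < m ∧ ∀ ω x, m ≤ frontSpeed P a b g q ω x := by
  have hA := effectiveCoefficient_pos (P := P) h.a_pos_finite (h.a_stationary.measurable 0)
  set A := effectiveCoefficient P a with hAdef
  obtain ⟨c, C, hc, ha⟩ := h.a_pos_finite
  obtain ⟨c', C', hc', hb⟩ := h.b_pos_finite
  -- Positivity of `C` is read off at a point of `Ω`.
  rcases isEmpty_or_nonempty Ω with hΩ | ⟨⟨ω₀⟩⟩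
  · exact ⟨1, one_pos, fun ω => hΩ.elim ω⟩
  have hC : 0 < C := hc.trans_le ((ha 0 ω₀).1.trans (ha 0 ω₀).2)
  refine ⟨q * c' * (A / C), by positivity, fun ω x => ?_⟩
  have h1 : A / C ≤ A / a x ω :=
    div_le_div_of_nonneg_left hA.le (hc.trans_le (ha x ω).1) (ha x ω).2
  have h2 : q * c' ≤ q * b x ω := mul_le_mul_of_nonneg_left (hb x ω).1 hq.le
  have h3 : q * c' * (A / C) ≤ q * b x ω * (A / a x ω) :=
    mul_le_mul h2 h1 (by positivity) ((mul_pos hq hc').le.trans h2)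
  exact h3.trans (le_add_of_nonneg_right (h.g_nonneg x ω))

theorem uniformlyLipschitz_frontSpeed (h : IsAdmissible τ a b g) :
    UniformlyLipschitz fun x ω => frontSpeed P a b g q ω x := by
  obtain ⟨c, C, hc, ha⟩ := h.a_pos_finite
  obtain ⟨B, hB⟩ := h.b_pos_finite.exists_abs_le
  have hinv : ∀ x ω, |(a x ω)⁻¹| ≤ c⁻¹ := fun x ω => by
    rw [abs_of_pos (inv_pos.2 (hc.trans_le (ha x ω).1))]
    exact inv_anti₀ hc (ha x ω).1
  obtain ⟨K, hK⟩ := h.b_lipschitz.mul (h.a_lipschitz.inv hc fun x ω => (ha x ω).1) hB hinv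
  obtain ⟨K', hK'⟩ := h.g_lipschitz
  set A := effectiveCoefficient P a with hA
  refine ⟨|q * A| * K + K', fun x y ω => ?_⟩
  have h1 : frontSpeed P a b g q ω x - frontSpeed P a b g q ω y =
      q * A * (b x ω * (a x ω)⁻¹ - b y ω * (a y ω)⁻¹) + (g x ω - g y ω) := by
    simp only [frontSpeed, ← hA, div_eq_mul_inv]; ring
  rw [h1, add_mul, mul_assoc |q * A|]
  refine (abs_add_le _ _).trans (add_le_add ?_ (hK' x y ω))
  rw [abs_mul]
  exact mul_le_mul_of_nonneg_left (hK x y ω) (abs_nonneg _)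

theorem continuous_frontSpeed (h : IsAdmissible τ a b g) (ω : Ω) :
    Continuous (frontSpeed P a b g q ω) := by
  obtain ⟨K, hK⟩ := (uniformlyLipschitz_frontSpeed (P := P) (q := q) h).exists_lipschitzWith
  exact (hK ω).continuous

theorem isForwardSolution_front (h : IsAdmissible τ a b g) (x₀ : ℝ) (ω : Ω) :
    IsForwardSolution (frontSpeed P a b g q ω) x₀ fun t => front P a b g q x₀ t ω := by
  obtain ⟨K, hK⟩ := (uniformlyLipschitz_frontSpeed (P := P) (q := q) h).exists_lipschitzWith
  exact odeSolution_spec (hK ω) x₀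

variable (P a b g q) in
/-- The slowness of the front: the inverse of its speed. -/
noncomputable def frontSlowness (x : ℝ) (ω : Ω) : ℝ := (frontSpeed P a b g q ω x)⁻¹

theorem frontSpeed_pos [IsProbabilityMeasure P] (h : IsAdmissible τ a b g) (hq : 0 < q) (ω : Ω)
    (x : ℝ) : 0 < frontSpeed P a b g q ω x := by
  obtain ⟨m, hm, hle⟩ := exists_le_frontSpeed (P := P) h hq
  exact hm.trans_le (hle ω x)

/-- No upper bound on `g` is assumed, so the speed may be unbounded; the slowness is bounded thanks
to the lower bound on the speed. -/
theorem exists_isBoundedField_frontSlowness [IsProbabilityMeasure P] (h : IsAdmissible τ a b g)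
    (hq : 0 < q) : ∃ M, IsBoundedField τ (frontSlowness P a b g q) M := by
  obtain ⟨m, hm, hle⟩ := exists_le_frontSpeed (P := P) h hq
  refine ⟨m⁻¹, ⟨fun x => (measurable_frontSpeed h x).inv, fun y z ω => ?_⟩, fun ω => ?_,
    fun x ω => ?_⟩
  · rw [frontSlowness, frontSlowness, frontSpeed_shift h]
  · exact (continuous_frontSpeed h ω).inv₀ fun x => (frontSpeed_pos h hq ω x).ne'
  · rw [frontSlowness, abs_of_pos (inv_pos.2 (frontSpeed_pos h hq ω x))]
    exact inv_anti₀ hm (hle ω x)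

theorem arrivalTime_eq [IsProbabilityMeasure P] (h : IsAdmissible τ a b g) (hq : 0 < q)
    {x₀ x₁ : ℝ} (hx : x₀ < x₁) (ω : Ω) :
    arrivalTime P a b g q x₁ x₀ ω = ∫ x in x₀..x₁, frontSlowness P a b g q x ω :=
  (isForwardSolution_front h x₀ ω).sInf_arrival_eq (continuous_frontSpeed h ω)
    (frontSpeed_pos h hq ω) hx

/-- The front in the shifted medium, described by the slowness in the original medium. -/
theorem integral_frontSlowness_front [IsProbabilityMeasure P] (h : IsAdmissible τ a b g)
    (hq : 0 < q) (x₀ y : ℝ) {t : ℝ} (ht : 0 ≤ t) (ω : Ω) :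
    ∫ x in x₀ + y..front P a b g q x₀ t (τ y ω) + y, frontSlowness P a b g q x ω = t := by
  obtain ⟨M, hM⟩ := exists_isBoundedField_frontSlowness (P := P) h hq
  rw [← hM.integral_shift]
  exact (isForwardSolution_front h x₀ (τ y ω)).integral_inv_eq
    (continuous_frontSpeed h _) (frontSpeed_pos h hq _) ht

/-! ### Mean slowness and the homogenized limits. -/

variable (P a b g q) in
/-- The mean travel time of the front through an interval of unit length. -/
noncomputable def meanSlowness : ℝ := ∫ ω, (∫ x in (0 : ℝ)..1, frontSlowness P a b g q x ω) ∂P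

theorem meanSlowness_pos [IsProbabilityMeasure P] (h : IsAdmissible τ a b g) (hq : 0 < q) :
    0 < meanSlowness P a b g q := by
  obtain ⟨M, hM⟩ := exists_isBoundedField_frontSlowness (P := P) h hq
  have hpos : ∀ ω, 0 < ∫ x in (0 : ℝ)..1, frontSlowness P a b g q x ω := fun ω =>
    intervalIntegral.intervalIntegral_pos_of_pos (hM.intervalIntegrable 0 1 ω)
      (fun x => inv_pos.2 (frontSpeed_pos h hq ω x)) one_pos
  refine (integral_pos_iff_support_of_nonneg (fun ω => (hpos ω).le)
    (hM.integrable_integral 0 1)).2 ?_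
  have : Function.support (fun ω => ∫ x in (0 : ℝ)..1, frontSlowness P a b g q x ω) = univ :=
    eq_univ_of_forall fun ω => (hpos ω).ne'
  simp [this]

/-- Travel times deviate sublinearly from their mean. -/
theorem ae_abs_integral_frontSlowness_sub_le [IsProbabilityMeasure P] (hτ : IsErgodicGroup P τ)
    (h : IsAdmissible τ a b g) (hq : 0 < q) :
    ∀ᵐ ω ∂P, ∀ δ > 0, ∃ C, 0 ≤ C ∧ ∀ s t, |(∫ x in s..t, frontSlowness P a b g q x ω) -
      meanSlowness P a b g q * (t - s)| ≤ δ * (|s| + |t|) + C := by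
  obtain ⟨M, hM⟩ := exists_isBoundedField_frontSlowness (P := P) h hq
  filter_upwards [hM.ae_abs_integral_sub_le hτ] with ω hω δ hδ
  obtain ⟨C, hC⟩ := hω δ hδ
  have hC0 : 0 ≤ C := by simpa using hC 0
  -- The integral over `[s, t]` is a difference of two integrals from `0`, each with error constant
  -- `C`.
  refine ⟨2 * C, by positivity, fun s t => ?_⟩
  change ∀ x, |_ - meanSlowness P a b g q * x| ≤ _ at hC
  rw [← intervalIntegral.integral_interval_sub_left (hM.intervalIntegrable 0 t ω)
    (hM.intervalIntegrable 0 s ω)]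
  have hs := abs_le.1 (hC s)
  have ht := abs_le.1 (hC t)
  rw [abs_le]
  constructor <;> linarith

theorem isEffectiveArrivalTime_meanSlowness [IsProbabilityMeasure P] (hτ : IsErgodicGroup P τ)
    (h : IsAdmissible τ a b g) (hq : 0 < q) :
    IsEffectiveArrivalTime P a b g q (meanSlowness P a b g q) := by
  intro x₀
  filter_upwards [ae_abs_integral_frontSlowness_sub_le hτ h hq] with ω hω
  rw [Metric.tendsto_atTop]
  intro η hη
  obtain ⟨C, hC0, hC⟩ := hω (η / 2) (half_pos hη)
  -- Beyond this threshold `η / 2 * (|x₀| + |x₀ + r|) + C < η * r`.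
  refine ⟨(η * |x₀| + C + 1) / (η / 2), fun r hr => ?_⟩
  rw [ge_iff_le, div_le_iff₀ (half_pos hη)] at hr
  have hx := abs_nonneg x₀
  have hr0 : 0 < r := by
    have : 0 < r * (η / 2) := lt_of_lt_of_le (by positivity) hr
    exact pos_of_mul_pos_left this (half_pos hη).le
  rw [arrivalTime_eq h hq (lt_add_of_pos_right x₀ hr0), Real.dist_eq, div_sub' hr0.ne', abs_div,
    abs_of_pos hr0, div_lt_iff₀ hr0]
  have h1 := hC x₀ (x₀ + r)
  rw [add_sub_cancel_left, mul_comm (meanSlowness P a b g q)] at h1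
  have h2 : |x₀ + r| ≤ |x₀| + r := (abs_add_le _ _).trans_eq (by rw [abs_of_pos hr0])
  have h3 := mul_le_mul_of_nonneg_left h2 (half_pos hη).le
  linarith

/-- The exceptional null set is the one of the ergodic theorem, hence common to all `x₀`, `Λ`, `t₁`
and all shifts. -/
theorem ae_tendsto_rescaledFront [IsProbabilityMeasure P] (hτ : IsErgodicGroup P τ)
    (h : IsAdmissible τ a b g) (hq : 0 < q) :
    ∀ᵐ ω ∂P, ∀ x₀ Λ t₁ : ℝ, 0 ≤ Λ → 0 ≤ t₁ → ∀ η > 0, ∀ᶠ ε in 𝓝[>] (0 : ℝ),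
      ∀ y t, |y| ≤ Λ / ε → t ∈ Icc 0 t₁ →
        |rescaledFront P a b g q ε x₀ t (τ y ω) - x₀ - 1 / meanSlowness P a b g q * t| ≤ η := by
  have hT := meanSlowness_pos (P := P) h hq
  filter_upwards [ae_abs_integral_frontSlowness_sub_le hτ h hq] with ω hω x₀ Λ t₁ hΛ ht₁ η hη
  set T := meanSlowness P a b g q with hTdef
  have hx₀ := abs_nonneg x₀
  -- `B` is an a priori bound for the rescaled displacement `|ε * R|`: since `δ ≤ T / 2`, half of `T
  -- * |ε * R|` is absorbed on the left. The final error is then at most `δ * D + ε * C`, and each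
  -- term is at most `η * T / 2`.
  set B := 2 / T * (t₁ + T * (|x₀| + Λ) + 1) with hB
  have hB0 : 0 ≤ B := by positivity
  set D := 2 * |x₀| + 2 * Λ + B + 1 with hD
  have hD0 : 0 < D := by positivity
  set δ := min (T / 2) (η * T / 2 / D) with hδ
  have hδ0 : 0 < δ := lt_min (by positivity) (by positivity)
  have hδT : δ ≤ T / 2 := min_le_left _ _
  have hδD : δ * D ≤ η * T / 2 := (le_div_iff₀ hD0).1 (min_le_right _ _)
  obtain ⟨C, hC0, hC⟩ := hω δ hδ0
  have hsmall : ∀ᶠ ε in 𝓝[>] (0 : ℝ), ε < 1 ∧ ε * C < min 1 (η * T / 2) := by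
    refine eventually_nhdsWithin_of_eventually_nhds ((eventually_lt_nhds one_pos).and ?_)
    have : Tendsto (fun ε : ℝ => ε * C) (𝓝 0) (𝓝 0) := by
      simpa using (tendsto_id (α := ℝ) (x := 𝓝 0)).mul_const C
    exact this.eventually_lt_const (lt_min one_pos (by positivity))
  filter_upwards [hsmall, self_mem_nhdsWithin] with ε ⟨hε1, hεC⟩ hε y t hy ht
  replace hε : 0 < ε := hε
  have hεC1 := (hεC.trans_le (min_le_left _ _)).le
  have hεC2 := (hεC.trans_le (min_le_right _ _)).le
  have hint := integral_frontSlowness_front (P := P) h hq x₀ y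
    (mul_nonneg (inv_pos.2 hε).le ht.1) ω
  have hdev := hC (x₀ + y) (front P a b g q x₀ (ε⁻¹ * t) (τ y ω) + y)
  rw [hint] at hdev
  set R := front P a b g q x₀ (ε⁻¹ * t) (τ y ω) - x₀ with hR
  have hfront : front P a b g q x₀ (ε⁻¹ * t) (τ y ω) = x₀ + R := by rw [hR]; ring
  have hresc : rescaledFront P a b g q ε x₀ t (τ y ω) = ε * R + x₀ := rfl
  rw [hfront] at hdev
  have h1 : |x₀ + y| + |x₀ + R + y| ≤ 2 * |x₀| + 2 * |y| + |R| := by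
    have h2 := abs_add_le x₀ y
    have h3 := abs_add_three x₀ R y
    linarith
  have hy' : ε * |y| ≤ Λ := by rw [mul_comm]; exact (le_div_iff₀ hε).1 hy
  -- The deviation bound multiplied by `ε`; the shift contributes only `ε * |y| ≤ Λ`.
  have h4 : |t - T * (ε * R)| ≤ δ * (2 * |x₀| + 2 * Λ + |ε * R|) + ε * C := by
    have h5 : t - T * (ε * R) = ε * (ε⁻¹ * t - T * (x₀ + R + y - (x₀ + y))) := by
      field_simp
      ring
    rw [h5, abs_mul, abs_of_pos hε]
    have h6 := mul_le_mul_of_nonneg_left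
      (hdev.trans (add_le_add_left (mul_le_mul_of_nonneg_left h1 hδ0.le) C)) hε.le
    refine h6.trans ?_
    have h7 : ε * |x₀| ≤ |x₀| := mul_le_of_le_one_left hx₀ hε1.le
    have h8 : |ε * R| = ε * |R| := by rw [abs_mul, abs_of_pos hε]
    have h9 : 2 * (ε * |x₀|) + 2 * (ε * |y|) + ε * |R| ≤ 2 * |x₀| + 2 * Λ + |ε * R| := by
      linarith
    have h10 := mul_le_mul_of_nonneg_left h9 hδ0.le
    linarith
  have hrB : |ε * R| ≤ B := by
    have h5 : T * |ε * R| ≤ t₁ + |t - T * (ε * R)| := by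
      have h6 := abs_sub_abs_le_abs_sub (T * (ε * R)) t
      rw [abs_mul, abs_of_pos hT, abs_of_nonneg ht.1, abs_sub_comm] at h6
      linarith [ht.2]
    have h6 : δ * (2 * |x₀| + 2 * Λ + |ε * R|) ≤ T / 2 * (2 * |x₀| + 2 * Λ + |ε * R|) :=
      mul_le_mul_of_nonneg_right hδT (by positivity)
    rw [hB, div_mul_eq_mul_div, le_div_iff₀ hT]
    linarith
  have h11 : δ * (2 * |x₀| + 2 * Λ + |ε * R|) ≤ δ * D :=
    mul_le_mul_of_nonneg_left (by linarith) hδ0.le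
  have h12 : rescaledFront P a b g q ε x₀ t (τ y ω) - x₀ - 1 / T * t =
      -(t - T * (ε * R)) / T := by
    rw [hresc]
    field_simp
    ring
  rw [h12, abs_div, abs_neg, abs_of_pos hT, div_le_iff₀ hT]
  linarith

end Speed

end FrontODE

theorem proposition4p5 {Ω : Type*} [MeasurableSpace Ω] (P : Measure Ω) [IsProbabilityMeasure P]
    (τ : ℝ → Ω → Ω) (hτ : IsErgodicGroup P τ)
    (a b g : ℝ → Ω → ℝ) (habg : IsAdmissible τ a b g) (q : ℝ) (hq : 0 < q) :
    ∃ V : ℝ, IsEffectiveVelocity P a b g q V ∧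
      ∀ x₀ Λ t₀ t₁ : ℝ, 0 < Λ → 0 < t₀ → t₀ < t₁ →
        ∀ᵐ ω ∂P, Tendsto
          (fun ε : ℝ => ⨆ (y : ℝ) (_ : |y| ≤ Λ / ε) (t : ℝ) (_ : t ∈ Icc t₀ t₁),
            ENNReal.ofReal |rescaledFront P a b g q ε x₀ t (τ y ω) - x₀ - V * t|)
          (𝓝[>] 0) (𝓝 0) := by
  refine ⟨1 / meanSlowness P a b g q, ⟨_, meanSlowness_pos habg hq,
    isEffectiveArrivalTime_meanSlowness hτ habg hq, rfl⟩, fun x₀ Λ t₀ t₁ hΛ ht₀ ht₁ => ?_⟩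
  filter_upwards [ae_tendsto_rescaledFront hτ habg hq] with ω hω
  rw [ENNReal.tendsto_nhds_zero]
  intro η hη
  -- Here `η` may be infinite, so a positive real number below it is used.
  obtain ⟨η', hη', hle⟩ := ENNReal.lt_iff_exists_real_btwn.1 hη
  have hpos : 0 < η' := ENNReal.ofReal_pos.1 hle.1
  filter_upwards [hω x₀ Λ t₁ hΛ.le (ht₀.trans ht₁).le η' hpos] with ε hε
  exact iSup₂_le fun y hy => iSup₂_le fun t ht =>
    (ENNReal.ofReal_le_ofReal (hε y t hy ⟨ht₀.le.trans ht.1, ht.2⟩)).trans hle.2.le
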